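/- Let $M$ be a smooth (Hausdorff, paracompact) $7$-manifold with a $G_2$-structure, that is, a smooth Riemannian metric $(\cdot,\cdot)$ and a smooth $3$-form $\lambda$ such that each tangent space $T_xM$ admits a linear isometry onto the space $\mathrm{Im}\,\mathbb O\cong\mathbb R^7$ of imaginary octonions taking $\lambda$ to the standard form $(a,b,c)\mapsto(\mathrm{Im}(ab),c)$; in particular, $M$ may be any $G_2$-manifold. Let $[\cdot,\cdot]$ be the vector product on the tangent spaces of $M$ defined by $([a,b],c)=\lambda(a,b,c)$. Let $T^0(M)$ be the complement of the zero section in $TM$, let $p:T^0(M)\to M$ be the projection, and let $I$ be the quotient of $p^*TM$ by its tautological line subbundle, identified with the bundle over $T^0(M)$ whose fibre at $v\in T^0(M)$ is the orthogonal complement of $v$ in $T_{p(v)}M$ (over the unit sphere bundle this is the tangent bundle along the fibres of $p$). Regard $I$ as a complex vector bundle of rank $3$ with the complex structure $J(w)=[e_0,w]$, where $e_0=v/|v|$. Then the first Chern class of $I$ is zero: $$c_1(I)=0\in H^2(T^0(M);\mathbb Z).$$ -/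

import Mathlib

open Bundle Manifold Set TopologicalSpace
open scoped ContDiff

noncomputable section

/-! ## Čech cohomology in degree two with integer coefficients -/

/-- An open cover of `X` indexed by the points of `X`, the member with index `x` being an open
neighbourhood of `x`. Every open cover has a refinement of this kind. -/
structure PointCover (X : Type*) [TopologicalSpace X] where
  /-- the members of the cover -/
  nhd : X → Set X
  isOpen (x : X) : IsOpen (nhd x)
  mem (x : X) : x ∈ nhd x

namespace PointCover

/-- The common refinement of two covers. -/
def inf {X : Type*} [TopologicalSpace X] (U V : PointCover X) : PointCover X where
  nhd x := U.nhd x ∩ V.nhd x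
  isOpen x := (U.isOpen x).inter (V.isOpen x)
  mem x := ⟨U.mem x, V.mem x⟩

/-- The one-element cover. -/
def top (X : Type*) [TopologicalSpace X] : PointCover X where
  nhd _ := univ
  isOpen _ := isOpen_univ
  mem _ := mem_univ _

end PointCover

namespace Cech

variable {X : Type*} [TopologicalSpace X]

/-- The coboundary of a `1`-cochain `f`: here `f x y p` is the value at the point `p` of the
component of `f` on the intersection of the members with indices `x` and `y`. -/
def d1 {A : Type*} [AddCommGroup A] (f : X → X → X → A) : X → X → X → X → A :=
  fun x y z p => f y z p - f x z p + f x y p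

/-- The coboundary of a `2`-cochain. -/
def d2 {A : Type*} [AddCommGroup A] (c : X → X → X → X → A) : X → X → X → X → X → A :=
  fun x y z w p => c y z w p - c x z w p + c x y w p - c x y z p

/-- Integral `2`-cocycles of point-indexed covers of `X`: on all the triple intersections of some
cover the components are continuous (that is, locally constant), and the coboundary vanishes on
its quadruple intersections. Values outside the intersections are immaterial. -/
def Z2 (X : Type*) [TopologicalSpace X] : AddSubgroup (X → X → X → X → ℤ) where
  carrier := {c | ∃ U : PointCover X,
    (∀ x y z, ContinuousOn (c x y z) (U.nhd x ∩ U.nhd y ∩ U.nhd z)) ∧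
    ∀ x y z w, ∀ p ∈ U.nhd x ∩ U.nhd y ∩ U.nhd z ∩ U.nhd w, d2 c x y z w p = 0}
  zero_mem' := ⟨PointCover.top X, fun _ _ _ => continuousOn_const, fun _ _ _ _ _ _ => by simp [d2]⟩
  add_mem' := by
    rintro a b ⟨U, hU, hU'⟩ ⟨V, hV, hV'⟩
    refine ⟨U.inf V, fun x y z => ?_, fun x y z w p hp => ?_⟩
    · exact ((hU x y z).mono fun p hp => ⟨⟨hp.1.1.1, hp.1.2.1⟩, hp.2.1⟩).add
        ((hV x y z).mono fun p hp => ⟨⟨hp.1.1.2, hp.1.2.2⟩, hp.2.2⟩)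
    · have h1 := hU' x y z w p ⟨⟨⟨hp.1.1.1.1, hp.1.1.2.1⟩, hp.1.2.1⟩, hp.2.1⟩
      have h2 := hV' x y z w p ⟨⟨⟨hp.1.1.1.2, hp.1.1.2.2⟩, hp.1.2.2⟩, hp.2.2⟩
      simp only [d2, Pi.add_apply] at h1 h2 ⊢
      linarith
  neg_mem' := by
    rintro a ⟨U, hU, hU'⟩
    refine ⟨U, fun x y z => (hU x y z).neg, fun x y z w p hp => ?_⟩
    have h1 := hU' x y z w p hp
    simp only [d2, Pi.neg_apply] at h1 ⊢
    linarith

/-- Integral `2`-coboundaries: the cocycles which, on the triple intersections of some cover,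
agree with the coboundary of a locally constant integral `1`-cochain. In particular cocycles
which agree on a finer cover become equal in the quotient by `B2 X`. -/
def B2 (X : Type*) [TopologicalSpace X] : AddSubgroup (Z2 X) where
  carrier := {c | ∃ (U : PointCover X) (b : X → X → X → ℤ),
    (∀ x y, ContinuousOn (b x y) (U.nhd x ∩ U.nhd y)) ∧
    ∀ x y z, ∀ p ∈ U.nhd x ∩ U.nhd y ∩ U.nhd z, c.1 x y z p = d1 b x y z p}
  zero_mem' := ⟨PointCover.top X, 0, fun _ _ => continuousOn_const, fun _ _ _ _ _ => by simp [d1]⟩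
  add_mem' := by
    rintro a b ⟨U, f, hU, hU'⟩ ⟨V, g, hV, hV'⟩
    refine ⟨U.inf V, f + g, fun x y => ?_, fun x y z p hp => ?_⟩
    · exact ((hU x y).mono fun p hp => ⟨hp.1.1, hp.2.1⟩).add
        ((hV x y).mono fun p hp => ⟨hp.1.2, hp.2.2⟩)
    · have h1 := hU' x y z p ⟨⟨hp.1.1.1, hp.1.2.1⟩, hp.2.1⟩
      have h2 := hV' x y z p ⟨⟨hp.1.1.2, hp.1.2.2⟩, hp.2.2⟩
      simp only [d1, Pi.add_apply, AddSubgroup.coe_add] at h1 h2 ⊢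
      linarith
  neg_mem' := by
    rintro a ⟨U, f, hU, hU'⟩
    refine ⟨U, -f, fun x y => (hU x y).neg, fun x y z p hp => ?_⟩
    have h1 := hU' x y z p hp
    simp only [d1, Pi.neg_apply, AddSubgroup.coe_neg] at h1 ⊢
    linarith

/-- The Čech cohomology group `H²(X; ℤ)`: the direct limit, over the open covers of `X`, of the
second cohomology groups of the complexes of locally constant integral cochains. -/
abbrev H2 (X : Type*) [TopologicalSpace X] : Type _ := Z2 X ⧸ B2 X

end Cech

/-! ## The first Chern class of a complex vector bundle -/

/-- The sections `s 0, …, s (n - 1)` are continuous on `U` and form a complex basis of the fibre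
over each point of `U`. -/
structure IsComplexFrameOn {X : Type*} (F : Type*) {E : X → Type*} [TopologicalSpace X]
    [∀ x, AddCommGroup (E x)] [∀ x, Module ℂ (E x)] [TopologicalSpace (TotalSpace F E)]
    {n : ℕ} (U : Set X) (s : Fin n → ∀ x, E x) : Prop where
  continuousOn (k : Fin n) : ContinuousOn (fun x => TotalSpace.mk' F x (s k x)) U
  linearIndependent (x : X) (hx : x ∈ U) : LinearIndependent ℂ fun k => s k x
  span_eq_top (x : X) (hx : x ∈ U) : Submodule.span ℂ (range fun k => s k x) = ⊤

/-- `c` is the first Chern class of the rank `n` complex vector bundle `E` over `X`: the image,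
under the connecting homomorphism of the exponential sequence
`0 → ℤ → C(·, ℂ) → C(·, ℂˣ) → 0`, of the Čech cocycle of determinants of transition matrices.
In detail: `s x` is a frame over the member `U x` of a cover, `s y = s x · A x y` over
`U x ∩ U y`, `det A x y = exp (2πi f x y)` with `f x y` continuous, and `c` is the class of the
integral cocycle `m` which is the coboundary of `f`. -/
def IsFirstChernClass {X : Type*} (F : Type*) (E : X → Type*) [TopologicalSpace X]
    [∀ x, AddCommGroup (E x)] [∀ x, Module ℂ (E x)] [TopologicalSpace (TotalSpace F E)]
    (n : ℕ) (c : Cech.H2 X) : Prop :=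
  ∃ (U : PointCover X) (s : X → Fin n → ∀ p, E p)
    (A : X → X → X → Matrix (Fin n) (Fin n) ℂ) (f : X → X → X → ℂ) (m : Cech.Z2 X),
    (∀ x, IsComplexFrameOn F (U.nhd x) (s x)) ∧
    (∀ x y, ∀ p ∈ U.nhd x ∩ U.nhd y, ∀ b, s y b p = ∑ a, A x y p a b • s x a p) ∧
    (∀ x y, ContinuousOn (f x y) (U.nhd x ∩ U.nhd y)) ∧
    (∀ x y, ∀ p ∈ U.nhd x ∩ U.nhd y,
      (A x y p).det = Complex.exp (2 * Real.pi * Complex.I * f x y p)) ∧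
    (∀ x y z, ∀ p ∈ U.nhd x ∩ U.nhd y ∩ U.nhd z, (m.1 x y z p : ℂ) = Cech.d1 f x y z p) ∧
    c = QuotientAddGroup.mk m

/-! ## The vector product on `ℝ⁷` -/

/-- Seven-dimensional Euclidean space, the space of imaginary octonions. -/
abbrev E7 : Type := EuclideanSpace ℝ (Fin 7)

/-- The vector product of imaginary octonions, `a × b = Im (a b) = (a b - b a) / 2`, in a standard
basis `e₀, …, e₆` of imaginary units: `e₀e₁ = e₂`, `e₀e₃ = e₄`, `e₀e₅ = e₆`, `e₁e₃ = e₅`,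
`e₁e₄ = -e₆`, `e₂e₃ = -e₆`, `e₂e₄ = -e₅`, and cyclically. -/
def cross0 (u v : E7) : E7 :=
  !₂[(u 1 * v 2 - u 2 * v 1) + (u 3 * v 4 - u 4 * v 3) + (u 5 * v 6 - u 6 * v 5),
    (u 2 * v 0 - u 0 * v 2) + (u 3 * v 5 - u 5 * v 3) - (u 4 * v 6 - u 6 * v 4),
    (u 0 * v 1 - u 1 * v 0) - (u 3 * v 6 - u 6 * v 3) - (u 4 * v 5 - u 5 * v 4),
    (u 4 * v 0 - u 0 * v 4) + (u 5 * v 1 - u 1 * v 5) - (u 6 * v 2 - u 2 * v 6),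
    (u 0 * v 3 - u 3 * v 0) - (u 6 * v 1 - u 1 * v 6) - (u 5 * v 2 - u 2 * v 5),
    (u 6 * v 0 - u 0 * v 6) + (u 1 * v 3 - u 3 * v 1) - (u 2 * v 4 - u 4 * v 2),
    (u 0 * v 5 - u 5 * v 0) - (u 1 * v 4 - u 4 * v 1) - (u 2 * v 3 - u 3 * v 2)]

/-- The standard `3`-form `(a × b, c)` on the imaginary octonions, whose stabilizer in
`GL(7, ℝ)` is the group `G₂`. -/
def phi0 (u v w : E7) : ℝ := inner ℝ (cross0 u v) w

theorem inner_E7 (u v : E7) : inner ℝ u v = u 0 * v 0 + u 1 * v 1 + u 2 * v 2 + u 3 * v 3 +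
    u 4 * v 4 + u 5 * v 5 + u 6 * v 6 := by
  simp [PiLp.inner_apply, Fin.sum_univ_succ, mul_comm]
  ring

theorem cross0_cross0 (u v : E7) :
    cross0 u (cross0 u v) = -(inner ℝ u u : ℝ) • v + (inner ℝ u v : ℝ) • u := by
  rw [inner_E7, inner_E7]
  ext i
  fin_cases i <;> simp [cross0] <;> ring

theorem phi0_left (u w : E7) : phi0 u w u = 0 := by
  simp [phi0, inner_E7, cross0]
  ring

/-! ## `G₂`-manifolds -/

instance instFiniteDimensionalTangentSpaceSeven {M : Type*} [TopologicalSpace M]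
    [ChartedSpace E7 M] (x : M) : FiniteDimensional ℝ (TangentSpace (𝓡 7) x) :=
  inferInstanceAs (FiniteDimensional ℝ E7)

/-- A `G₂`-structure on a smooth `7`-manifold: a smooth Riemannian metric and a smooth `3`-form
such that every tangent space is isometric to the space of imaginary octonions by a linear map
which takes the `3`-form to the standard one. Smoothness of the `3`-form means smoothness of its
components in local coordinates; that it is alternating is part of the last condition. -/
structure G2Structure (M : Type*) [TopologicalSpace M] [ChartedSpace E7 M]
    [IsManifold (𝓡 7) ∞ M] where
  /-- the Riemannian metric -/
  metric : ContMDiffRiemannianMetric (𝓡 7) ∞ E7 (fun x : M => TangentSpace (𝓡 7) x)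
  /-- the `3`-form -/
  form (x : M) : TangentSpace (𝓡 7) x →ₗ[ℝ] TangentSpace (𝓡 7) x →ₗ[ℝ]
    TangentSpace (𝓡 7) x →ₗ[ℝ] ℝ
  contMDiffOn_form (x₀ : M) (a b c : E7) : ContMDiffOn (𝓡 7) 𝓘(ℝ) ∞
    (fun x => form x ((trivializationAt E7 (TangentSpace (𝓡 7)) x₀).symm x a)
      ((trivializationAt E7 (TangentSpace (𝓡 7)) x₀).symm x b)
      ((trivializationAt E7 (TangentSpace (𝓡 7)) x₀).symm x c))
    (trivializationAt E7 (TangentSpace (𝓡 7)) x₀).baseSet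
  exists_model (x : M) : ∃ e : TangentSpace (𝓡 7) x ≃L[ℝ] E7,
    (∀ u v, metric.inner x u v = inner ℝ (e u) (e v)) ∧
    ∀ u v w, form x u v w = phi0 (e u) (e v) (e w)

namespace G2Structure

variable {M : Type*} [TopologicalSpace M] [ChartedSpace E7 M] [IsManifold (𝓡 7) ∞ M]
  (S : G2Structure M)

/-- The metric at `x`, as a bilinear form. -/
def bilin (x : M) : LinearMap.BilinForm ℝ (TangentSpace (𝓡 7) x) :=
  LinearMap.mk₂ ℝ (fun u v => S.metric.inner x u v) (by simp) (by simp) (by simp) (by simp)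

@[simp] theorem bilin_apply (x : M) (u v : TangentSpace (𝓡 7) x) :
    S.bilin x u v = S.metric.inner x u v := rfl

theorem bilin_nondegenerate (x : M) : (S.bilin x).Nondegenerate := by
  constructor
  · intro u hu
    by_contra h
    exact (S.metric.pos x u h).ne' (hu u)
  · intro u hu
    by_contra h
    exact (S.metric.pos x u h).ne' (hu u)

/-- The vector product `[·,·]` on the tangent space at `x`, determined by
`([u, v], w) = form x u v w`. -/
def cross (x : M) : TangentSpace (𝓡 7) x →ₗ[ℝ] TangentSpace (𝓡 7) x →ₗ[ℝ]
    TangentSpace (𝓡 7) x :=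
  (S.form x).compr₂ ((S.bilin x).toDual (S.bilin_nondegenerate x)).symm.toLinearMap

theorem inner_cross (x : M) (u v w : TangentSpace (𝓡 7) x) :
    S.metric.inner x (S.cross x u v) w = S.form x u v w :=
  LinearMap.BilinForm.apply_toDual_symm_apply (hB := S.bilin_nondegenerate x) (S.form x u v) w

theorem cross_cross (x : M) (u v : TangentSpace (𝓡 7) x) :
    S.cross x u (S.cross x u v) =
      -(S.metric.inner x u u) • v + (S.metric.inner x u v) • u := by
  obtain ⟨e, he, hf⟩ := S.exists_model x
  have key : ∀ a b, e (S.cross x a b) = cross0 (e a) (e b) := by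
    intro a b
    refine ext_inner_right ℝ fun w => ?_
    obtain ⟨w, rfl⟩ := e.surjective w
    rw [← he, inner_cross, hf, phi0]
  apply e.injective
  rw [key, key, cross0_cross0, map_add, map_smul, map_smul, he, he]

theorem inner_cross_self (x : M) (u w : TangentSpace (𝓡 7) x) :
    S.metric.inner x u (S.cross x u w) = 0 := by
  obtain ⟨e, -, hf⟩ := S.exists_model x
  rw [S.metric.symm, inner_cross, hf, phi0_left]

end G2Structure

/-! ## The complex bundle over the complement of the zero section -/

/-- The complement `T⁰(M)` of the zero section in the tangent bundle of `M`, with the subspace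
topology. -/
abbrev T0 (M : Type*) [TopologicalSpace M] [ChartedSpace E7 M] [IsManifold (𝓡 7) ∞ M] : Type _ :=
  {v : TangentBundle (𝓡 7) M // v.2 ≠ 0}

namespace G2Structure

variable {M : Type*} [TopologicalSpace M] [ChartedSpace E7 M] [IsManifold (𝓡 7) ∞ M]
  (S : G2Structure M)

/-- The fibre at `v ∈ T⁰(M)` of the bundle `I`: the orthogonal complement of `v` in the tangent
space of `M` at the foot point of `v`; it represents the quotient of that tangent space by the
line spanned by `v`, and if `v` has length one it is the tangent space at `v` to the fibre of the
unit sphere bundle. -/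
def perp (v : T0 M) : Submodule ℝ (TangentSpace (𝓡 7) v.1.1) :=
  LinearMap.ker (S.bilin v.1.1 v.1.2)

theorem mem_perp (v : T0 M) (w : TangentSpace (𝓡 7) v.1.1) :
    w ∈ S.perp v ↔ S.metric.inner v.1.1 v.1.2 w = 0 := Iff.rfl

/-- The unit vector `e₀ = v / |v|`. -/
def unit (v : T0 M) : TangentSpace (𝓡 7) v.1.1 :=
  (Real.sqrt (S.metric.inner v.1.1 v.1.2 v.1.2))⁻¹ • v.1.2

theorem inner_unit_unit (v : T0 M) : S.metric.inner v.1.1 (S.unit v) (S.unit v) = 1 := by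
  have h := S.metric.pos v.1.1 v.1.2 v.2
  have h' := Real.sqrt_pos.2 h
  simp only [unit, map_smul, smul_apply, smul_eq_mul]
  nth_rewrite 3 [← Real.mul_self_sqrt h.le]
  field_simp

theorem inner_unit_of_mem (v : T0 M) (w : TangentSpace (𝓡 7) v.1.1) (hw : w ∈ S.perp v) :
    S.metric.inner v.1.1 (S.unit v) w = 0 := by
  rw [mem_perp] at hw
  simp [unit, hw]

theorem cross_mem_perp (v : T0 M) (w : TangentSpace (𝓡 7) v.1.1) :
    S.cross v.1.1 (S.unit v) w ∈ S.perp v := by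
  have h : S.metric.inner v.1.1 v.1.2 (S.cross v.1.1 v.1.2 w) = 0 := S.inner_cross_self _ _ _
  rw [mem_perp]
  simp [unit, h]

/-- The complex structure `J w = [e₀, w]` on the fibre at `v`. -/
def J (v : T0 M) : Module.End ℝ (S.perp v) :=
  (S.cross v.1.1 (S.unit v)).restrict fun w _ => S.cross_mem_perp v w

theorem J_mul_J (v : T0 M) : S.J v * S.J v = -1 := by
  ext w
  change S.cross v.1.1 (S.unit v) (S.cross v.1.1 (S.unit v) w.1) = -w.1
  rw [cross_cross, inner_unit_unit, inner_unit_of_mem S v w.1 w.2]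
  simp

/-- The fibre at `v` of the bundle `I`, as a complex vector space with `√-1` acting as `J`. -/
def Fibre (v : T0 M) : Type := S.perp v

instance (v : T0 M) : AddCommGroup (S.Fibre v) :=
  inferInstanceAs (AddCommGroup (S.perp v))

instance (v : T0 M) : Module ℂ (S.Fibre v) :=
  letI : Module (Module.End ℝ (S.perp v)) (S.Fibre v) :=
    inferInstanceAs (Module (Module.End ℝ (S.perp v)) (S.perp v))
  Module.compHom (S.Fibre v) (Complex.lift ⟨S.J v, S.J_mul_J v⟩).toRingHom

/-- The vector of the tangent bundle of `M` underlying a vector of the bundle `I`. -/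
def toTangent (w : TotalSpace (Fin 3 → ℂ) S.Fibre) : TangentBundle (𝓡 7) M :=
  ⟨w.1.1.1, Subtype.val (p := fun u => u ∈ S.perp w.1) w.2⟩

/-- The topology of the total space of `I`, as a subspace of the pull-back to `T⁰(M)` of the
tangent bundle of `M`, which in turn is a subspace of `T⁰(M) × TM`. -/
instance : TopologicalSpace (TotalSpace (Fin 3 → ℂ) S.Fibre) :=
  TopologicalSpace.induced (fun w => (w.1, S.toTangent w)) inferInstance

theorem complex_smul_def (v : T0 M) (z : ℂ) (w : S.perp v) :
    (z • (show S.Fibre v from w) : S.Fibre v) = (z.re • w + z.im • S.J v w : S.perp v) := by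
  change (Complex.lift ⟨S.J v, S.J_mul_J v⟩ z) w = _
  simp [Module.algebraMap_end_apply]

end G2Structure

end

/-!
Write `u = v / |v|` and `J w = [u, w]`. Polarising `[u, [u, w]] = -|u|² w + (u, w) u` shows that on
the orthogonal complement of `v` the `3`-form satisfies `λ(Ja, b, c) = λ(a, Jb, c) = λ(a, b, Jc)`.
Hence `Ω(a, b, c) = λ(a, b, c) - i λ(Ja, b, c)` is a complex-trilinear alternating form. It vanishes
nowhere, because `λ(a, b, [a, b]) = |[a, b]|² = |a|² |b|² ≠ 0` for nonzero `a ⊥ v` and nonzero `b`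
orthogonal to `v`, `a` and `Ja`. So `Ω` trivialises the determinant line bundle of `I`: choosing
logarithms of the values of `Ω` on local frames writes the logarithms of the determinants of the
transition matrices as a coboundary up to integers, and `c₁(I) = 0`.
-/

/-! ## The exponential sequence -/

theorem exp_two_pi_I_mul_eq_iff {a b : ℂ} :
    Complex.exp (2 * Real.pi * Complex.I * a) = Complex.exp (2 * Real.pi * Complex.I * b) ↔
      ∃ k : ℤ, k = a - b := by
  rw [Complex.exp_eq_exp_iff_exists_int]
  refine exists_congr fun k => ?_
  rw [← mul_right_inj' Complex.two_pi_I_ne_zero (b := (k : ℂ))]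
  constructor <;> intro h <;> linear_combination -h

theorem exists_nhds_continuousOn_exp_eq {X : Type*} [TopologicalSpace X] {U : Set X}
    (hU : IsOpen U) {x : X} (hx : x ∈ U) {g : X → ℂ} (hg : ContinuousOn g U)
    (hg0 : ∀ p ∈ U, g p ≠ 0) :
    ∃ V ⊆ U, IsOpen V ∧ x ∈ V ∧ ∃ h : X → ℂ, ContinuousOn h V ∧
      ∀ p ∈ V, Complex.exp (2 * Real.pi * Complex.I * h p) = g p := by
  have hgx : ContinuousOn (fun p => g p / g x) U := hg.div_const _
  refine ⟨U ∩ (fun p => g p / g x) ⁻¹' Complex.slitPlane, inter_subset_left,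
    hgx.isOpen_inter_preimage hU Complex.isOpen_slitPlane, ⟨hx, ?_⟩,
    fun p => (Complex.log (g p / g x) + Complex.log (g x)) / (2 * Real.pi * Complex.I), ?_, ?_⟩
  · simp [div_self (hg0 x hx)]
  · exact (((hgx.mono inter_subset_left).clog fun p hp => hp.2).add continuousOn_const).div_const _
  · rintro p ⟨hp, -⟩
    have hgx0 := hg0 x hx
    rw [mul_div_cancel₀ _ Complex.two_pi_I_ne_zero, Complex.exp_add,
      Complex.exp_log (div_ne_zero (hg0 p hp) hgx0), Complex.exp_log hgx0, div_mul_cancel₀ _ hgx0]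

theorem PointCover.exists_subordinate_exp_eq {X : Type*} [TopologicalSpace X] (U : PointCover X)
    {g : X → X → ℂ} (hg : ∀ x, ContinuousOn (g x) (U.nhd x))
    (hg0 : ∀ x, ∀ p ∈ U.nhd x, g x p ≠ 0) :
    ∃ (V : PointCover X) (h : X → X → ℂ), (∀ x, V.nhd x ⊆ U.nhd x) ∧
      (∀ x, ContinuousOn (h x) (V.nhd x)) ∧
      ∀ x, ∀ p ∈ V.nhd x, Complex.exp (2 * Real.pi * Complex.I * h x p) = g x p := by
  choose V hVU hVo hxV h hcont hexp using fun x =>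
    exists_nhds_continuousOn_exp_eq (U.isOpen x) (U.mem x) (hg x) (hg0 x)
  exact ⟨⟨V, hVo, hxV⟩, h, hVU, hcont, hexp⟩

theorem continuousOn_of_continuousOn_intCast {X : Type*} [TopologicalSpace X] {U : Set X}
    {b : X → ℤ} (hb : ContinuousOn (fun p => (b p : ℂ)) U) : ContinuousOn b U := by
  have hre : ContinuousOn (fun p => (b p : ℝ)) U :=
    (Complex.continuous_re.comp_continuousOn hb).congr fun p _ => (Complex.intCast_re _).symm
  exact Int.isClosedEmbedding_coe_real.isInducing.continuousOn_iff.2 hre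

namespace Cech

variable {X : Type*}

/-- The coboundary of a `0`-cochain `h`, in the conventions of `Cech.d1`: here `h x p` is the value
at the point `p` of the component of `h` on the member with index `x`. -/
def d0 {A : Type*} [AddCommGroup A] (h : X → X → A) : X → X → X → A :=
  fun x y p => h y p - h x p

theorem d1_d0 {A : Type*} [AddCommGroup A] (h : X → X → A) : d1 (d0 h) = 0 := by
  funext x y z p
  simp [d1, d0]

theorem mk_eq_zero_of_sub_d0_eq_intCast [TopologicalSpace X] {U : PointCover X} {m : Z2 X}
    {f : X → X → X → ℂ} {h : X → X → ℂ} (hf : ∀ x y, ContinuousOn (f x y) (U.nhd x ∩ U.nhd y))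
    (hh : ∀ x, ContinuousOn (h x) (U.nhd x))
    (hm : ∀ x y z, ∀ p ∈ U.nhd x ∩ U.nhd y ∩ U.nhd z, (m.1 x y z p : ℂ) = d1 f x y z p)
    (hfh : ∀ x y, ∀ p ∈ U.nhd x ∩ U.nhd y, ∃ k : ℤ, k = f x y p - d0 h x y p) :
    (QuotientAddGroup.mk m : H2 X) = 0 := by
  choose! b hb using hfh
  refine (QuotientAddGroup.eq_zero_iff m).2 ⟨U, b, fun x y => ?_, fun x y z p hp => ?_⟩
  · exact continuousOn_of_continuousOn_intCast (((hf x y).sub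
      (((hh y).mono inter_subset_right).sub ((hh x).mono inter_subset_left))).congr (hb x y))
  · apply Int.cast_injective (α := ℂ)
    rw [hm x y z p hp]
    simp only [d1]
    push_cast
    rw [hb x y p hp.1, hb y z p ⟨hp.1.2, hp.2⟩, hb x z p ⟨hp.1.1, hp.2⟩]
    simp only [d0]
    ring

end Cech

/-! ## Complex volume forms -/

namespace IsComplexFrameOn

variable {X F : Type*} {E : X → Type*} [TopologicalSpace X] [∀ x, AddCommGroup (E x)]
  [∀ x, Module ℂ (E x)] [TopologicalSpace (TotalSpace F E)] {n : ℕ} {U V : Set X}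
  {s : Fin n → ∀ x, E x}

theorem mono (h : IsComplexFrameOn F V s) (hU : U ⊆ V) : IsComplexFrameOn F U s :=
  ⟨fun k => (h.continuousOn k).mono hU, fun x hx => h.linearIndependent x (hU hx),
    fun x hx => h.span_eq_top x (hU hx)⟩

theorem exists_basis (h : IsComplexFrameOn F U s) {x : X} (hx : x ∈ U) :
    ∃ b : Module.Basis (Fin n) ℂ (E x), ⇑b = fun k => s k x :=
  ⟨.mk (h.linearIndependent x hx) (h.span_eq_top x hx).ge, Module.Basis.coe_mk _ _⟩

theorem exists_transition (h : IsComplexFrameOn F U s) {x : X} (hx : x ∈ U)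
    (t : Fin n → E x) : ∃ A : Matrix (Fin n) (Fin n) ℂ, ∀ j, t j = ∑ i, A i j • s i x := by
  obtain ⟨b, hb⟩ := h.exists_basis hx
  refine ⟨b.toMatrix t, fun j => ?_⟩
  rw [← b.sum_toMatrix_smul_self t j, hb]

theorem map_transition (h : IsComplexFrameOn F U s) {x : X} (hx : x ∈ U)
    (Ω : E x [⋀^Fin n]→ₗ[ℂ] ℂ) {t : Fin n → E x} {A : Matrix (Fin n) (Fin n) ℂ}
    (ht : ∀ j, t j = ∑ i, A i j • s i x) : Ω t = A.det * Ω fun k => s k x := by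
  obtain ⟨b, hb⟩ := h.exists_basis hx
  have hA : b.toMatrix t = A := by
    ext i j
    rw [Module.Basis.toMatrix_apply, ht, ← congrFun (b.repr_sum_self fun i => A i j) i, hb]
  rw [Ω.eq_smul_basis_det b, AlternatingMap.smul_apply, AlternatingMap.smul_apply,
    Module.Basis.det_apply, hA, ← hb, b.det_self, smul_eq_mul, smul_eq_mul, mul_one, mul_comm]

end IsComplexFrameOn

/-- A continuous nowhere vanishing complex volume form on the rank `n` complex vector bundle `E`,
that is, a trivialization of its determinant line bundle. Since only the total space of `E` carries
a topology, continuity is tested on sections. -/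
structure IsComplexVolumeForm {X : Type*} (F : Type*) {E : X → Type*} [TopologicalSpace X]
    [∀ x, AddCommGroup (E x)] [∀ x, Module ℂ (E x)] [TopologicalSpace (TotalSpace F E)]
    {n : ℕ} (Ω : ∀ x, E x [⋀^Fin n]→ₗ[ℂ] ℂ) : Prop where
  ne_zero (x : X) : Ω x ≠ 0
  continuousAt (x : X) (s : Fin n → ∀ x, E x)
    (hs : ∀ k, ContinuousAt (fun y => TotalSpace.mk' F y (s k y)) x) :
    ContinuousAt (fun y => Ω y fun k => s k y) x

namespace IsComplexVolumeForm

variable {X F : Type*} {E : X → Type*} [TopologicalSpace X] [∀ x, AddCommGroup (E x)]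
  [∀ x, Module ℂ (E x)] [TopologicalSpace (TotalSpace F E)] {n : ℕ}
  {Ω : ∀ x, E x [⋀^Fin n]→ₗ[ℂ] ℂ}

theorem continuousOn (hΩ : IsComplexVolumeForm F Ω) {U : Set X} (hU : IsOpen U)
    {s : Fin n → ∀ x, E x} (hs : ∀ k, ContinuousOn (fun y => TotalSpace.mk' F y (s k y)) U) :
    ContinuousOn (fun y => Ω y fun k => s k y) U := fun x hx =>
  (hΩ.continuousAt x s fun k => (hs k).continuousAt (hU.mem_nhds hx)).continuousWithinAt

theorem apply_frame_ne_zero (hΩ : IsComplexVolumeForm F Ω) {U : Set X} {s : Fin n → ∀ x, E x}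
    (hs : IsComplexFrameOn F U s) {x : X} (hx : x ∈ U) : Ω x (fun k => s k x) ≠ 0 := by
  obtain ⟨b, hb⟩ := hs.exists_basis hx
  rw [← hb]
  exact mt ((Ω x).map_basis_eq_zero_iff b).1 (hΩ.ne_zero x)

theorem exists_log (hΩ : IsComplexVolumeForm F Ω) {U : PointCover X} {s : X → Fin n → ∀ p, E p}
    (hs : ∀ x, IsComplexFrameOn F (U.nhd x) (s x)) :
    ∃ (V : PointCover X) (h : X → X → ℂ), (∀ x, V.nhd x ⊆ U.nhd x) ∧
      (∀ x, ContinuousOn (h x) (V.nhd x)) ∧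
      ∀ x, ∀ p ∈ V.nhd x,
        Complex.exp (2 * Real.pi * Complex.I * h x p) = Ω p fun k => s x k p :=
  U.exists_subordinate_exp_eq (fun x => hΩ.continuousOn (U.isOpen x) (hs x).continuousOn)
    fun x _ hp => hΩ.apply_frame_ne_zero (hs x) hp

theorem exp_d0_eq_det {V : PointCover X} {s : X → Fin n → ∀ p, E p}
    (hs : ∀ x, IsComplexFrameOn F (V.nhd x) (s x)) {h : X → X → ℂ}
    (hh : ∀ x, ∀ p ∈ V.nhd x, Complex.exp (2 * Real.pi * Complex.I * h x p) = Ω p fun k => s x k p)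
    {x y p : X} (hp : p ∈ V.nhd x ∩ V.nhd y) {A : Matrix (Fin n) (Fin n) ℂ}
    (hA : ∀ j, s y j p = ∑ i, A i j • s x i p) :
    Complex.exp (2 * Real.pi * Complex.I * Cech.d0 h x y p) = A.det := by
  rw [Cech.d0, mul_sub, Complex.exp_sub, hh y p hp.2, hh x p hp.1,
    (hs x).map_transition hp.1 (Ω p) hA, ← hh x p hp.1,
    mul_div_cancel_right₀ _ (Complex.exp_ne_zero _)]

theorem eq_zero_of_isFirstChernClass (hΩ : IsComplexVolumeForm F Ω) {c : Cech.H2 X}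
    (hc : IsFirstChernClass F E n c) : c = 0 := by
  obtain ⟨U, s, A, f, m, hs, hA, hf, hdet, hm, rfl⟩ := hc
  obtain ⟨V, h, hVU, hcont, hexp⟩ := hΩ.exists_log hs
  have hVU₂ : ∀ x y, V.nhd x ∩ V.nhd y ⊆ U.nhd x ∩ U.nhd y := fun x y =>
    inter_subset_inter (hVU x) (hVU y)
  refine Cech.mk_eq_zero_of_sub_d0_eq_intCast (U := V) (fun x y => (hf x y).mono (hVU₂ x y)) hcont
    (fun x y z p hp => hm x y z p (inter_subset_inter (hVU₂ x y) (hVU z) hp)) fun x y p hp => ?_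
  rw [← exp_two_pi_I_mul_eq_iff, ← hdet x y p (hVU₂ x y hp),
    exp_d0_eq_det (fun x => (hs x).mono (hVU x)) hexp hp (hA x y p (hVU₂ x y hp))]

theorem isFirstChernClass_zero (hΩ : IsComplexVolumeForm F Ω)
    (hE : ∀ x, ∃ (U : Set X) (s : Fin n → ∀ p, E p), IsOpen U ∧ x ∈ U ∧ IsComplexFrameOn F U s) :
    IsFirstChernClass F E n 0 := by
  choose U s hUo hxU hs using hE
  obtain ⟨V, h, hVU, hcont, hexp⟩ := hΩ.exists_log (U := ⟨U, hUo, hxU⟩) hs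
  have hsV : ∀ x, IsComplexFrameOn F (V.nhd x) (s x) := fun x => (hs x).mono (hVU x)
  choose! A hA using fun x y p (hp : p ∈ V.nhd x ∩ V.nhd y) =>
    (hsV x).exists_transition hp.1 fun k => s y k p
  refine ⟨V, s, A, Cech.d0 h, 0, hsV, hA, fun x y => ?_, fun x y p hp => ?_, fun x y z p _ => ?_,
    rfl⟩
  · exact ((hcont y).mono inter_subset_right).sub ((hcont x).mono inter_subset_left)
  · exact (exp_d0_eq_det hsV hexp hp (hA x y p hp)).symm
  · simp [Cech.d1_d0]

theorem exists_isComplexFrameOn (hΩ : IsComplexVolumeForm F Ω)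
    (b : ∀ x, Module.Basis (Fin n) ℂ (E x)) {x : X}
    (hext : ∀ w : E x, ∃ s : ∀ y, E y, s x = w ∧
      ∀ᶠ y in nhds x, ContinuousAt (fun y => TotalSpace.mk' F y (s y)) y) :
    ∃ (U : Set X) (s : Fin n → ∀ p, E p), IsOpen U ∧ x ∈ U ∧ IsComplexFrameOn F U s := by
  choose s hsb hs using fun k => hext (b x k)
  have hΩs : Ω x (fun k => s k x) ≠ 0 := by
    simpa only [hsb] using mt ((Ω x).map_basis_eq_zero_iff (b x)).1 (hΩ.ne_zero x)
  have hΩcont := hΩ.continuousAt x s fun k => (hs k).self_of_nhds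
  obtain ⟨U, hU, hUo, hxU⟩ := eventually_nhds_iff.1
    ((hΩcont.eventually_ne hΩs).and (Filter.eventually_all.2 hs))
  have hli : ∀ y ∈ U, LinearIndependent ℂ fun k => s k y := fun y hy =>
    not_imp_comm.1 ((Ω y).map_linearDependent _) (hU y hy).1
  refine ⟨U, s, hUo, hxU, fun k y hy => ((hU y hy).2 k).continuousWithinAt, hli, fun y hy => ?_⟩
  have := Module.Finite.of_basis (b y)
  exact (hli y hy).span_eq_top_of_card_eq_finrank' (Module.finrank_eq_card_basis (b y)).symm

theorem isFirstChernClass_iff (hΩ : IsComplexVolumeForm F Ω)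
    (hE : ∀ x, ∃ (U : Set X) (s : Fin n → ∀ p, E p), IsOpen U ∧ x ∈ U ∧ IsComplexFrameOn F U s)
    {c : Cech.H2 X} : IsFirstChernClass F E n c ↔ c = 0 :=
  ⟨hΩ.eq_zero_of_isFirstChernClass, fun hc => hc ▸ hΩ.isFirstChernClass_zero hE⟩

end IsComplexVolumeForm

/-! ## Continuous sections of vector bundles -/

theorem continuousAt_of_clm_apply {P F G : Type*} [TopologicalSpace P] [NormedAddCommGroup F]
    [NormedSpace ℝ F] [CompleteSpace F] [NormedAddCommGroup G] [NormedSpace ℝ G] {p₀ : P}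
    {A : P → F →L[ℝ] G} {c : P → F} (hA : ContinuousAt A p₀) (hA₀ : (A p₀).IsInvertible)
    (hAc : ContinuousAt (fun p => A p (c p)) p₀) : ContinuousAt c p₀ := by
  have hinv : ContinuousAt (fun p => (A p).inverse) p₀ :=
    (hA₀.contDiffAt_map_inverse (n := 0)).continuousAt.comp hA
  have hA' : ∀ᶠ p in nhds p₀, (A p).IsInvertible := by
    obtain ⟨e, he⟩ := hA₀
    exact hA.eventually (he ▸ e.nhds)
  refine (hinv.clm_apply hAc).congr ?_
  filter_upwards [hA'] with p hp
  exact hp.inverse_apply_self (c p)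

theorem isInvertible_toContinuousBilinearMap {F : Type*} [NormedAddCommGroup F] [NormedSpace ℝ F]
    [FiniteDimensional ℝ F] {β : LinearMap.BilinForm ℝ F} (hβ : β.Nondegenerate) :
    (LinearMap.toContinuousBilinearMap β).IsInvertible :=
  ⟨((LinearMap.BilinForm.toDual β hβ).trans
    LinearMap.toContinuousLinearMap).toContinuousLinearEquiv, rfl⟩

section FiberBundle

variable {B F P : Type*} {E : B → Type*} [TopologicalSpace B] [TopologicalSpace F]
  [TopologicalSpace P] [TopologicalSpace (TotalSpace F E)] {x : P → B} {p₀ : P}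

theorem eventually_mem_baseSet {t : Trivialization F (TotalSpace.proj : TotalSpace F E → B)}
    (hx : ContinuousAt x p₀) (hx₀ : x p₀ ∈ t.baseSet) : ∀ᶠ p in nhds p₀, x p ∈ t.baseSet :=
  hx.eventually (t.open_baseSet.mem_nhds hx₀)

theorem continuousAt_section_symm [∀ b, Zero (E b)]
    {t : Trivialization F (TotalSpace.proj : TotalSpace F E → B)}
    (hx : ContinuousAt x p₀) (hx₀ : x p₀ ∈ t.baseSet) (v : F) :
    ContinuousAt (fun p => TotalSpace.mk' F (x p) (t.symm (x p) v)) p₀ :=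
  (t.continuousOn_symm.continuousAt
    ((t.open_baseSet.prod isOpen_univ).mem_nhds ⟨hx₀, mem_univ v⟩)).comp
      (f := fun p => (x p, v)) (hx.prodMk continuousAt_const)

end FiberBundle

section VectorBundle

variable {B F P : Type*} {E : B → Type*} [TopologicalSpace B] [TopologicalSpace P]
  [NormedAddCommGroup F] [NormedSpace ℝ F] [TopologicalSpace (TotalSpace F E)]
  [∀ b, TopologicalSpace (E b)] [∀ b, AddCommGroup (E b)] [∀ b, Module ℝ (E b)]
  [FiberBundle F E] [VectorBundle ℝ F E] {x : P → B} {p₀ : P} {a b : ∀ p, E (x p)}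

theorem continuousAt_section_iff :
    ContinuousAt (fun p => TotalSpace.mk' F (x p) (a p)) p₀ ↔ ContinuousAt x p₀ ∧
      ContinuousAt (fun p => (trivializationAt F E (x p₀)).linearMapAt ℝ (x p) (a p)) p₀ := by
  rw [FiberBundle.continuousAt_totalSpace]
  refine and_congr_right fun hx => continuousAt_congr ?_
  filter_upwards [eventually_mem_baseSet hx (mem_baseSet_trivializationAt F E (x p₀))] with p hp
  rw [Trivialization.coe_linearMapAt_of_mem _ hp]

theorem continuousAt_section_smul {f : P → ℝ} (hf : ContinuousAt f p₀)
    (ha : ContinuousAt (fun p => TotalSpace.mk' F (x p) (a p)) p₀) :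
    ContinuousAt (fun p => TotalSpace.mk' F (x p) (f p • a p)) p₀ := by
  rw [continuousAt_section_iff] at ha ⊢
  simp only [map_smul]
  exact ⟨ha.1, hf.smul ha.2⟩

theorem continuousAt_section_sub (ha : ContinuousAt (fun p => TotalSpace.mk' F (x p) (a p)) p₀)
    (hb : ContinuousAt (fun p => TotalSpace.mk' F (x p) (b p)) p₀) :
    ContinuousAt (fun p => TotalSpace.mk' F (x p) (a p - b p)) p₀ := by
  rw [continuousAt_section_iff] at ha hb ⊢
  simp only [map_sub]
  exact ⟨ha.1, ha.2.sub hb.2⟩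

theorem continuousAt_linearMap_section [FiniteDimensional ℝ F] {G : Type*} [NormedAddCommGroup G]
    [NormedSpace ℝ G] {L : ∀ p, E (x p) →ₗ[ℝ] G}
    (hL : ∀ v : F, ContinuousAt (fun p => L p ((trivializationAt F E (x p₀)).symm (x p) v)) p₀)
    (ha : ContinuousAt (fun p => TotalSpace.mk' F (x p) (a p)) p₀) :
    ContinuousAt (fun p => L p (a p)) p₀ := by
  set t := trivializationAt F E (x p₀)
  obtain ⟨hx, ha⟩ := continuousAt_section_iff.1 ha
  have hmem := eventually_mem_baseSet hx (mem_baseSet_trivializationAt F E (x p₀))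
  have hA : ContinuousAt (fun p => LinearMap.toContinuousLinearMap (L p ∘ₗ t.symmₗ ℝ (x p))) p₀ :=
    continuousAt_clm_apply.2 fun v => (hL v).congr <| by
      filter_upwards [hmem] with p hp
      simp [t.symmₗ_apply hp]
  refine (hA.clm_apply ha).congr ?_
  filter_upwards [hmem] with p hp
  exact congrArg (L p) (t.symmₗ_linearMapAt hp (a p))

theorem continuousAt_section_of_bilin [FiniteDimensional ℝ F]
    {β : ∀ p, LinearMap.BilinForm ℝ (E (x p))}
    (hβ : ∀ v w : F, ContinuousAt (fun p => β p ((trivializationAt F E (x p₀)).symm (x p) v)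
      ((trivializationAt F E (x p₀)).symm (x p) w)) p₀)
    (hβ₀ : (β p₀).Nondegenerate) (hx : ContinuousAt x p₀)
    (ha : ∀ w : F, ContinuousAt
      (fun p => β p (a p) ((trivializationAt F E (x p₀)).symm (x p) w)) p₀) :
    ContinuousAt (fun p => TotalSpace.mk' F (x p) (a p)) p₀ := by
  set t := trivializationAt F E (x p₀)
  have hx₀ := mem_baseSet_trivializationAt F E (x p₀)
  have hmem := eventually_mem_baseSet hx hx₀
  let A : P → F →L[ℝ] F →L[ℝ] ℝ := fun p =>
    LinearMap.toContinuousBilinearMap ((β p).compl₁₂ (t.symmₗ ℝ (x p)) (t.symmₗ ℝ (x p)))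
  have hA : ContinuousAt A p₀ :=
    continuousAt_clm_apply.2 fun v => continuousAt_clm_apply.2 fun w => (hβ v w).congr <| by
      filter_upwards [hmem] with p hp
      simp [A, t.symmₗ_apply hp]
  have hA₀ : (A p₀).IsInvertible := by
    refine isInvertible_toContinuousBilinearMap ?_
    convert hβ₀.congr (t.linearEquivAt ℝ (x p₀) hx₀) using 1
    ext v w
    simp [t.symmₗ_apply hx₀]
  have hAa : ContinuousAt (fun p => A p (t.linearMapAt ℝ (x p) (a p))) p₀ :=
    continuousAt_clm_apply.2 fun w => (ha w).congr <| by
      filter_upwards [hmem] with p hp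
      simp only [A, LinearMap.toContinuousBilinearMap_apply, LinearMap.compl₁₂_apply,
        t.symmₗ_linearMapAt hp, t.symmₗ_apply hp]
  exact continuousAt_section_iff.2 ⟨hx, continuousAt_of_clm_apply hA hA₀ hAa⟩

end VectorBundle

/-! ## Linear algebra -/

theorem exists_ne_zero_forall_dual_apply_eq_zero {K V ι : Type*} [DivisionRing K] [AddCommGroup V]
    [Module K V] [FiniteDimensional K V] [Fintype ι] (hι : Fintype.card ι < Module.finrank K V)
    (f : ι → V →ₗ[K] K) : ∃ w : V, w ≠ 0 ∧ ∀ i, f i w = 0 := by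
  have hker : LinearMap.ker (LinearMap.pi f) ≠ ⊥ :=
    LinearMap.ker_ne_bot_of_finrank_lt (by simpa using hι)
  obtain ⟨w, hw, hw0⟩ := Submodule.exists_mem_ne_zero_of_ne_bot hker
  exact ⟨w, hw0, congrFun hw⟩

/-- The alternating map of degree three given by a trilinear map which vanishes when its first
argument equals the second or the third one. -/
def alternatingMapOfTrilinear {R V N : Type*} [CommRing R] [AddCommGroup V] [Module R V]
    [AddCommGroup N] [Module R N] (f : V →ₗ[R] V →ₗ[R] V →ₗ[R] N) (h₁₂ : ∀ a b, f a a b = 0)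
    (h₁₃ : ∀ a b, f a b a = 0) : V [⋀^Fin 3]→ₗ[R] N where
  toMultilinearMap := MultilinearMap.mk' (fun w => f (w 0) (w 1) (w 2))
    (fun w i a b => by fin_cases i <;> simp) fun w i r a => by fin_cases i <;> simp
  map_eq_zero_of_eq' w i j hw hij := by
    have h₂₃ : ∀ a b, f a b b = 0 := fun a b => by
      have hswap := LinearMap.congr_fun (LinearMap.IsAlt.neg (fun a => LinearMap.ext (h₁₂ a)) b a) b
      simpa [h₁₃] using hswap.symm
    fin_cases i <;> fin_cases j <;> simp_all

section ComplexAlternatingMap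

variable {V ι : Type*} [AddCommGroup V] [Module ℂ V] [Module ℝ V] [DecidableEq ι] {i₀ : ι}

theorem map_update_I_smul_eq_zero_of_eq {φ : V [⋀^ι]→ₗ[ℝ] ℝ}
    (hφ : ∀ w i, φ (Function.update w i (Complex.I • w i)) =
      φ (Function.update w i₀ (Complex.I • w i₀)))
    {w : ι → V} {i j : ι} (hw : w i = w j) (hij : i ≠ j) :
    φ (Function.update w i₀ (Complex.I • w i₀)) = 0 := by
  have hswap : Function.update w i (Complex.I • w i) ∘ Equiv.swap i j =
      Function.update w j (Complex.I • w j) := by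
    ext k
    rcases eq_or_ne k i with rfl | hki
    · simp [hij, hij.symm, hw]
    rcases eq_or_ne k j with rfl | hkj
    · simp [hw]
    · simp [hki, hkj, Equiv.swap_apply_of_ne_of_ne]
  have hneg := φ.map_swap (Function.update w i (Complex.I • w i)) hij
  rw [hswap, hφ w i, hφ w j] at hneg
  exact self_eq_neg.1 hneg

variable [IsScalarTower ℝ ℂ V]

/-- The complex-multilinear alternating form with real part `φ`, provided that multiplication by
`Complex.I` may be moved from one argument of `φ` to any other. -/
noncomputable def complexAlternatingMap (φ : V [⋀^ι]→ₗ[ℝ] ℝ) (i₀ : ι)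
    (hφ : ∀ w i, φ (Function.update w i (Complex.I • w i)) =
      φ (Function.update w i₀ (Complex.I • w i₀))) : V [⋀^ι]→ₗ[ℂ] ℂ :=
  have hlin (w : ι → V) (i : ι) (a : V) :
      (φ (Function.update w i a) - Complex.I *
        φ (Function.update (Function.update w i a) i₀ (Complex.I • Function.update w i a i₀)) : ℂ) =
      Module.Dual.extendRCLike (𝕜 := ℂ) (φ.toMultilinearMap.toLinearMap w i) a := by
    rw [← hφ _ i]
    simp [Module.Dual.extendRCLike_apply]
  { MultilinearMap.mk'
      (fun w => (φ w - Complex.I * φ (Function.update w i₀ (Complex.I • w i₀)) : ℂ))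
      (fun w i a b => by rw [hlin, hlin, hlin, map_add])
      fun w i z a => by rw [hlin, hlin, map_smul] with
    map_eq_zero_of_eq' w i j hw hij := by
      simp [φ.map_eq_zero_of_eq w hw hij, map_update_I_smul_eq_zero_of_eq hφ hw hij] }

variable {φ : V [⋀^ι]→ₗ[ℝ] ℝ} {hφ : ∀ w i, φ (Function.update w i (Complex.I • w i)) =
  φ (Function.update w i₀ (Complex.I • w i₀))}

theorem complexAlternatingMap_apply (w : ι → V) : complexAlternatingMap φ i₀ hφ w =
    φ w - Complex.I * φ (Function.update w i₀ (Complex.I • w i₀)) := rfl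

theorem re_complexAlternatingMap (w : ι → V) : (complexAlternatingMap φ i₀ hφ w).re = φ w := by
  simp [complexAlternatingMap_apply]

end ComplexAlternatingMap

/-! ## The vector product of a `G₂`-structure -/

namespace G2Structure

variable {M : Type*} [TopologicalSpace M] [ChartedSpace E7 M] [IsManifold (𝓡 7) ∞ M]
  (S : G2Structure M)

section Algebra

variable (y : M) {u a b c : TangentSpace (𝓡 7) y}

theorem isAlt_cross : (S.cross y).IsAlt := fun u => by
  rcases eq_or_ne u 0 with rfl | hu
  · simp
  have hcross : S.cross y u (S.cross y u u) = 0 := by rw [cross_cross, neg_smul, neg_add_cancel]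
  have hsmul := S.cross_cross y u (S.cross y u u)
  rw [hcross, map_zero, inner_cross_self, zero_smul, add_zero, neg_smul, zero_eq_neg] at hsmul
  exact (smul_eq_zero.1 hsmul).resolve_left (S.metric.pos y u hu).ne'

theorem isAlt_form : (S.form y).IsAlt := fun u => by
  ext w
  rw [← inner_cross, S.isAlt_cross y u]
  simp

theorem form_apply_self_right (u w : TangentSpace (𝓡 7) y) : S.form y u w u = 0 := by
  rw [← inner_cross, S.metric.symm, inner_cross_self]

theorem form_swap (a b c : TangentSpace (𝓡 7) y) : S.form y b a c = -S.form y a b c :=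
  (LinearMap.congr_fun ((S.isAlt_form y).neg a b) c).symm

theorem form_rotate (a b c : TangentSpace (𝓡 7) y) : S.form y b c a = S.form y a b c := by
  have h := S.form_apply_self_right y (a + c) b
  simp only [map_add, LinearMap.add_apply, form_apply_self_right, zero_add, add_zero] at h
  rw [S.form_swap y c b a]
  linarith

theorem cross_cross_add_cross_cross (u v w : TangentSpace (𝓡 7) y) :
    S.cross y u (S.cross y v w) + S.cross y v (S.cross y u w) =
      -(2 * S.metric.inner y u v) • w + S.metric.inner y u w • v + S.metric.inner y v w • u := by
  have h := S.cross_cross y (u + v) w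
  simp only [map_add, LinearMap.add_apply, add_apply, cross_cross, S.metric.symm y v u] at h
  linear_combination (norm := module) h

theorem form_cross_left (ha : S.metric.inner y u a = 0) (hb : S.metric.inner y u b = 0)
    (hc : S.metric.inner y u c = 0) :
    S.form y (S.cross y u a) b c = S.form y a (S.cross y u b) c := by
  have hpolar : S.form y u (S.cross y c b) a + S.form y c (S.cross y u b) a = 0 := by
    have h := congrArg (S.metric.inner y · a) (S.cross_cross_add_cross_cross y u c b)
    simpa [inner_cross, ha, hb, hc] using h
  have hleft : S.form y u (S.cross y c b) a = S.form y (S.cross y u a) b c :=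
    calc S.form y u (S.cross y c b) a
      _ = -S.form y u a (S.cross y c b) := by rw [S.form_rotate y a, form_swap]
      _ = -S.form y c b (S.cross y u a) := by
        rw [← inner_cross, S.metric.symm, inner_cross]
      _ = S.form y (S.cross y u a) b c := by rw [← form_swap, S.form_rotate]
  have hright : S.form y c (S.cross y u b) a = -S.form y a (S.cross y u b) c := by
    rw [form_swap, S.form_rotate y a]
  linarith

theorem form_cross_right (ha : S.metric.inner y u a = 0) (hb : S.metric.inner y u b = 0)
    (hc : S.metric.inner y u c = 0) :
    S.form y a b (S.cross y u c) = S.form y (S.cross y u a) b c := by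
  rw [form_rotate, S.form_cross_left y hc ha hb, ← S.form_rotate y c]

theorem exists_form_ne_zero (u : TangentSpace (𝓡 7) y) : ∃ a : Fin 3 → TangentSpace (𝓡 7) y,
    (∀ i, S.metric.inner y u (a i) = 0) ∧ S.form y (a 0) (a 1) (a 2) ≠ 0 := by
  have hdim : Module.finrank ℝ (TangentSpace (𝓡 7) y) = 7 :=
    finrank_euclideanSpace_fin (𝕜 := ℝ) (n := 7)
  obtain ⟨a, ha, hua⟩ := exists_ne_zero_forall_dual_apply_eq_zero (by simp [hdim]) ![S.bilin y u]
  obtain ⟨b, hb, hub⟩ := exists_ne_zero_forall_dual_apply_eq_zero (by simp [hdim])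
    ![S.bilin y u, S.bilin y a, S.bilin y (S.cross y u a)]
  have hub₀ : S.metric.inner y u b = 0 := hub 0
  have hab₀ : S.metric.inner y a b = 0 := hub 1
  have hcab₀ : S.metric.inner y (S.cross y u a) b = 0 := hub 2
  have hcross : S.cross y a b ≠ 0 := fun h => by
    have hzero := S.cross_cross y a b
    rw [h, map_zero, hab₀, zero_smul, add_zero, eq_comm, smul_eq_zero] at hzero
    exact hzero.elim (neg_ne_zero.2 (S.metric.pos y a ha).ne') hb
  have hucab₀ : S.metric.inner y u (S.cross y a b) = 0 := by
    rw [S.metric.symm, inner_cross, form_rotate, ← inner_cross, hcab₀]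
  refine ⟨![a, b, S.cross y a b], fun i => ?_, ?_⟩
  · fin_cases i
    exacts [hua 0, hub₀, hucab₀]
  · change S.form y a b (S.cross y a b) ≠ 0
    rw [← inner_cross]
    exact (S.metric.pos y _ hcross).ne'

end Algebra

section Continuity

variable {P : Type*} [TopologicalSpace P] {x : P → M} {p₀ : P}
  {a b c : ∀ p, TangentSpace (𝓡 7) (x p)}

theorem continuousAt_metric
    (ha : ContinuousAt (fun p => (⟨x p, a p⟩ : TangentBundle (𝓡 7) M)) p₀)
    (hb : ContinuousAt (fun p => (⟨x p, b p⟩ : TangentBundle (𝓡 7) M)) p₀) :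
    ContinuousAt (fun p => S.metric.inner (x p) (a p) (b p)) p₀ := by
  have hm : ContinuousAt (fun p => TotalSpace.mk' (E7 →L[ℝ] E7 →L[ℝ] ℝ)
      (E := fun y : M => TangentSpace (𝓡 7) y →L[ℝ] TangentSpace (𝓡 7) y →L[ℝ] ℝ)
      (x p) (S.metric.inner (x p))) p₀ :=
    ContinuousAt.comp (f := x) S.metric.contMDiff.continuous.continuousAt
      (continuousAt_section_iff.1 ha).1
  have h := ContinuousAt.clm_bundle_apply₂ (E₃ := Bundle.Trivial M ℝ) (F₃ := ℝ) hm ha hb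
  exact ((FiberBundle.continuousAt_totalSpace ℝ _).1 h).2

theorem continuousAt_form
    (ha : ContinuousAt (fun p => (⟨x p, a p⟩ : TangentBundle (𝓡 7) M)) p₀)
    (hb : ContinuousAt (fun p => (⟨x p, b p⟩ : TangentBundle (𝓡 7) M)) p₀)
    (hc : ContinuousAt (fun p => (⟨x p, c p⟩ : TangentBundle (𝓡 7) M)) p₀) :
    ContinuousAt (fun p => S.form (x p) (a p) (b p) (c p)) p₀ := by
  set t := trivializationAt E7 (TangentSpace (𝓡 7)) (x p₀)
  have hx : ContinuousAt x p₀ := (continuousAt_section_iff.1 ha).1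
  have hsymm (u v w : E7) : ContinuousAt
      (fun p => S.form (x p) (t.symm (x p) u) (t.symm (x p) v) (t.symm (x p) w)) p₀ :=
    ((S.contMDiffOn_form (x p₀) u v w).continuousOn.continuousAt
      (t.open_baseSet.mem_nhds (mem_baseSet_trivializationAt _ _ _))).comp (f := x) hx
  have hleft (v w : E7) : ContinuousAt
      (fun p => S.form (x p) (a p) (t.symm (x p) v) (t.symm (x p) w)) p₀ :=
    continuousAt_linearMap_section
      (L := fun p => ((S.form (x p)).flip (t.symm (x p) v)).flip (t.symm (x p) w))
      (fun u => hsymm u v w) ha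
  have hmiddle (w : E7) : ContinuousAt
      (fun p => S.form (x p) (a p) (b p) (t.symm (x p) w)) p₀ :=
    continuousAt_linearMap_section (L := fun p => (S.form (x p) (a p)).flip (t.symm (x p) w))
      (fun v => hleft v w) hb
  exact continuousAt_linearMap_section (L := fun p => S.form (x p) (a p) (b p)) hmiddle hc

theorem continuousAt_cross
    (ha : ContinuousAt (fun p => (⟨x p, a p⟩ : TangentBundle (𝓡 7) M)) p₀)
    (hb : ContinuousAt (fun p => (⟨x p, b p⟩ : TangentBundle (𝓡 7) M)) p₀) :
    ContinuousAt (fun p => (⟨x p, S.cross (x p) (a p) (b p)⟩ : TangentBundle (𝓡 7) M)) p₀ := by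
  have hx : ContinuousAt x p₀ := (continuousAt_section_iff.1 ha).1
  have hsymm (v : E7) := continuousAt_section_symm hx
    (mem_baseSet_trivializationAt E7 (TangentSpace (𝓡 7)) (x p₀)) v
  refine continuousAt_section_of_bilin (β := fun p => S.bilin (x p))
    (fun v w => S.continuousAt_metric (hsymm v) (hsymm w)) (S.bilin_nondegenerate _) hx fun w => ?_
  simp only [bilin_apply, inner_cross]
  exact S.continuousAt_form ha hb (hsymm w)

theorem continuousAt_unit (v : T0 M) :
    ContinuousAt (fun v : T0 M => (⟨v.1.1, S.unit v⟩ : TangentBundle (𝓡 7) M)) v := by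
  have hv : ContinuousAt (fun v : T0 M => (⟨v.1.1, v.1.2⟩ : TangentBundle (𝓡 7) M)) v :=
    continuous_subtype_val.continuousAt
  exact continuousAt_section_smul ((S.continuousAt_metric hv hv).sqrt.inv₀
    (Real.sqrt_pos.2 (S.metric.pos v.1.1 v.1.2 v.2)).ne') hv

end Continuity

/-! ## The complex volume form -/

section Fibre

variable (v : T0 M)

/-- The fibre of `I` at `v`, as a real vector space, is the orthogonal complement of `v`. -/
noncomputable def fibreEquiv : S.Fibre v ≃ₗ[ℝ] S.perp v where
  toFun w := w
  invFun w := w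
  map_add' _ _ := rfl
  map_smul' r w := by
    have h := S.complex_smul_def v r w
    rwa [Complex.ofReal_re, Complex.ofReal_im, zero_smul, add_zero] at h
  left_inv _ := rfl
  right_inv _ := rfl

/-- The inclusion of a fibre of `I` into the tangent space of `M`. -/
noncomputable def fibreSubtype : S.Fibre v →ₗ[ℝ] TangentSpace (𝓡 7) v.1.1 :=
  (S.perp v).subtype ∘ₗ (S.fibreEquiv v).toLinearMap

theorem fibreSubtype_I_smul (w : S.Fibre v) : S.fibreSubtype v (Complex.I • w) =
    S.cross v.1.1 (S.unit v) (S.fibreSubtype v w) := by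
  have h := S.complex_smul_def v Complex.I (S.fibreEquiv v w)
  rw [Complex.I_re, Complex.I_im, zero_smul, one_smul, zero_add] at h
  exact congrArg Subtype.val h

theorem inner_unit_fibreSubtype (w : S.Fibre v) :
    S.metric.inner v.1.1 (S.unit v) (S.fibreSubtype v w) = 0 :=
  S.inner_unit_of_mem v _ (S.fibreEquiv v w).2

theorem finrank_fibre : Module.finrank ℂ (S.Fibre v) = 3 := by
  have hne : S.bilin v.1.1 v.1.2 ≠ 0 := fun h =>
    (S.metric.pos v.1.1 v.1.2 v.2).ne' (LinearMap.congr_fun h v.1.2)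
  have htangent : Module.finrank ℝ (TangentSpace (𝓡 7) v.1.1) = 7 :=
    finrank_euclideanSpace_fin (𝕜 := ℝ) (n := 7)
  have hperp : Module.finrank ℝ (S.perp v) + 1 = 7 :=
    (Module.Dual.finrank_ker_add_one_of_ne_zero hne).trans htangent
  have hreal := (S.fibreEquiv v).finrank_eq
  rw [finrank_real_of_complex] at hreal
  omega

/-- The restriction of the `3`-form to a fibre of `I`. -/
noncomputable def fibreForm : S.Fibre v [⋀^Fin 3]→ₗ[ℝ] ℝ :=
  (alternatingMapOfTrilinear (S.form v.1.1) (fun a b => LinearMap.congr_fun (S.isAlt_form _ a) b)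
    (S.form_apply_self_right _)).compLinearMap (S.fibreSubtype v)

theorem fibreForm_apply (w : Fin 3 → S.Fibre v) : S.fibreForm v w = S.form v.1.1
    (S.fibreSubtype v (w 0)) (S.fibreSubtype v (w 1)) (S.fibreSubtype v (w 2)) := rfl

theorem fibreForm_update_I_smul (w : Fin 3 → S.Fibre v) (i : Fin 3) :
    S.fibreForm v (Function.update w i (Complex.I • w i)) =
      S.fibreForm v (Function.update w 0 (Complex.I • w 0)) := by
  have h := fun k => S.inner_unit_fibreSubtype v (w k)
  fin_cases i
  · rfl
  · simp [fibreForm_apply, fibreSubtype_I_smul, S.form_cross_left v.1.1 (h 0) (h 1) (h 2)]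
  · simp [fibreForm_apply, fibreSubtype_I_smul, S.form_cross_right v.1.1 (h 0) (h 1) (h 2)]

/-- The complex volume form on the fibre of `I` at `v`, with real part the `3`-form. -/
noncomputable def volumeForm : S.Fibre v [⋀^Fin 3]→ₗ[ℂ] ℂ :=
  complexAlternatingMap (S.fibreForm v) 0 (S.fibreForm_update_I_smul v)

theorem volumeForm_ne_zero : S.volumeForm v ≠ 0 := fun h => by
  obtain ⟨a, ha, hform⟩ := S.exists_form_ne_zero v.1.1 v.1.2
  have hre := re_complexAlternatingMap (hφ := S.fibreForm_update_I_smul v)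
    fun k => (S.fibreEquiv v).symm ⟨a k, ha k⟩
  exact hform (hre.symm.trans (congrArg Complex.re (DFunLike.congr_fun h _)))

/-- The orthogonal projection onto a fibre of `I`. -/
noncomputable def proj (w : TangentSpace (𝓡 7) v.1.1) : S.Fibre v :=
  (S.fibreEquiv v).symm
    ⟨w - (S.metric.inner v.1.1 v.1.2 w / S.metric.inner v.1.1 v.1.2 v.1.2) • v.1.2, by
      simp [mem_perp, (S.metric.pos v.1.1 v.1.2 v.2).ne']⟩

theorem fibreSubtype_proj (w : TangentSpace (𝓡 7) v.1.1) : S.fibreSubtype v (S.proj v w) =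
    w - (S.metric.inner v.1.1 v.1.2 w / S.metric.inner v.1.1 v.1.2 v.1.2) • v.1.2 := rfl

theorem proj_fibreSubtype (w : S.Fibre v) : S.proj v (S.fibreSubtype v w) = w := by
  have hw : S.metric.inner v.1.1 v.1.2 (S.fibreSubtype v w) = 0 := (S.fibreEquiv v w).2
  apply Subtype.ext
  change S.fibreSubtype v (S.proj v (S.fibreSubtype v w)) = S.fibreSubtype v w
  rw [fibreSubtype_proj, hw, zero_div, zero_smul, sub_zero]

end Fibre

section Sections

variable {v : T0 M}

theorem continuousAt_fibre_iff {w : ∀ v, S.Fibre v} :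
    ContinuousAt (fun v => TotalSpace.mk' (Fin 3 → ℂ) v (w v)) v ↔
      ContinuousAt
        (fun v : T0 M => (⟨v.1.1, S.fibreSubtype v (w v)⟩ : TangentBundle (𝓡 7) M)) v := by
  have hind : Topology.IsInducing
      (fun w : TotalSpace (Fin 3 → ℂ) S.Fibre => (w.1, S.toTangent w)) := ⟨rfl⟩
  rw [hind.continuousAt_iff]
  exact ⟨fun h => h.snd, fun h => continuousAt_id.prodMk h⟩

theorem isComplexVolumeForm_volumeForm : IsComplexVolumeForm (Fin 3 → ℂ) S.volumeForm where
  ne_zero := S.volumeForm_ne_zero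
  continuousAt v s hs := by
    have hs' := fun k => S.continuousAt_fibre_iff.1 (hs k)
    have hre := S.continuousAt_form (hs' 0) (hs' 1) (hs' 2)
    have him := S.continuousAt_form (S.continuousAt_cross (S.continuousAt_unit v) (hs' 0))
      (hs' 1) (hs' 2)
    refine (Complex.continuous_ofReal.continuousAt.comp hre).sub (continuousAt_const.mul
      (Complex.continuous_ofReal.continuousAt.comp (him.congr (.of_forall fun y => ?_))))
    simp [fibreForm_apply, fibreSubtype_I_smul]

theorem continuousAt_proj {w : ∀ v : T0 M, TangentSpace (𝓡 7) v.1.1}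
    (hw : ContinuousAt (fun v : T0 M => (⟨v.1.1, w v⟩ : TangentBundle (𝓡 7) M)) v) :
    ContinuousAt (fun v => TotalSpace.mk' (Fin 3 → ℂ) v (S.proj v (w v))) v := by
  have hv : ContinuousAt (fun v : T0 M => (⟨v.1.1, v.1.2⟩ : TangentBundle (𝓡 7) M)) v :=
    continuous_subtype_val.continuousAt
  rw [continuousAt_fibre_iff]
  simp only [fibreSubtype_proj]
  exact continuousAt_section_sub hw (continuousAt_section_smul ((S.continuousAt_metric hv hw).div
    (S.continuousAt_metric hv hv) (S.metric.pos v.1.1 v.1.2 v.2).ne') hv)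

theorem exists_continuousAt_section (w : S.Fibre v) : ∃ s : ∀ y, S.Fibre y, s v = w ∧
    ∀ᶠ y in nhds v, ContinuousAt (fun y => TotalSpace.mk' (Fin 3 → ℂ) y (s y)) y := by
  set t := trivializationAt E7 (TangentSpace (𝓡 7)) v.1.1
  have hfoot : Continuous fun y : T0 M => y.1.1 :=
    (FiberBundle.continuous_proj E7 (TangentSpace (𝓡 7))).comp continuous_subtype_val
  have hv : v.1.1 ∈ t.baseSet := mem_baseSet_trivializationAt E7 (TangentSpace (𝓡 7)) v.1.1
  refine ⟨fun y => S.proj y (t.symm y.1.1 (t ⟨v.1.1, S.fibreSubtype v w⟩).2), ?_, ?_⟩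
  · beta_reduce
    rw [t.symm_apply_apply_mk hv, proj_fibreSubtype]
  · filter_upwards [eventually_mem_baseSet hfoot.continuousAt hv] with y hy
    exact S.continuousAt_proj (continuousAt_section_symm hfoot.continuousAt hy _)

theorem exists_isComplexFrameOn (v : T0 M) : ∃ (U : Set (T0 M)) (s : Fin 3 → ∀ v, S.Fibre v),
    IsOpen U ∧ v ∈ U ∧ IsComplexFrameOn (Fin 3 → ℂ) U s :=
  S.isComplexVolumeForm_volumeForm.exists_isComplexFrameOn
    (fun y => have := Module.finite_of_finrank_eq_succ (S.finrank_fibre y)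
      Module.finBasisOfFinrankEq ℂ (S.Fibre y) (S.finrank_fibre y))
    S.exists_continuousAt_section

end Sections

end G2Structure

theorem lemmaL_general {M : Type*} [TopologicalSpace M] [ChartedSpace E7 M]
    [IsManifold (𝓡 7) ∞ M] (S : G2Structure M) (c : Cech.H2 (T0 M)) :
    IsFirstChernClass (Fin 3 → ℂ) S.Fibre 3 c ↔ c = 0 :=
  S.isComplexVolumeForm_volumeForm.isFirstChernClass_iff S.exists_isComplexFrameOn

theorem lemmaL {M : Type*} [TopologicalSpace M] [T2Space M] [ParacompactSpace M]
    [ChartedSpace E7 M] [IsManifold (𝓡 7) ∞ M] (S : G2Structure M) :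
    (∃ c : Cech.H2 (T0 M), IsFirstChernClass (Fin 3 → ℂ) S.Fibre 3 c) ∧
      ∀ c : Cech.H2 (T0 M), IsFirstChernClass (Fin 3 → ℂ) S.Fibre 3 c → c = 0 :=
  ⟨⟨0, (lemmaL_general S 0).2 rfl⟩, fun c => (lemmaL_general S c).1⟩
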